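/- A non-negative measure $\mu$ on $\mathbb{R}$ is called admissible if it has finite moments $s_k(\mu)=\int_{\mathbb{R}} x^k\,d\mu(x)$ of all orders $k\ge 0$. For a closed set $K\subset\mathbb{R}$ let $\mathcal{M}(K)$ denote the set of moment sequences $(s_k(\mu))_{k\ge 0}$ of the admissible measures $\mu$ supported on $K$. For $F:\mathbb{R}\to\mathbb{R}$ let $F[-]$ denote the entrywise application of $F$ to sequences and matrices. An absolutely monotonic entire function is an entire function whose Taylor coefficients at every point of $(0,\infty)$ are non-negative. **Theorem.** The following are equivalent for a function $F:\mathbb{R}\to\mathbb{R}$. 1. $F[-]$ maps the sequences in $\bigcup_{u\in(0,1)}\mathcal{M}(\{-1,u,1\})$ into $\mathcal{M}(\mathbb{R})$. 2. $F[-]$ maps $\mathcal{M}([-1,1])$ into $\mathcal{M}(\mathbb{R})$. 3. $F$ is the restriction to $\mathbb{R}$ of an absolutely monotonic entire function. In particular, if $F[H]$ is positive semidefinite for every real positive semidefinite semi-infinite Hankel matrix $H=(s_{i+j})_{i,j\ge 0}$ of rank at most $3$, then (3) holds, and $F[A]$ is positive semidefinite for every real positive semidefinite matrix $A$ of any finite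 size. (A semi-infinite matrix is called positive semidefinite if it is symmetric and its quadratic form is non-negative on all finitely supported vectors.) -/

import Mathlib

open MeasureTheory
open scoped ComplexOrder

/-- A non-negative measure on the real line is admissible if it has moments of all orders. -/
def IsAdmissible (μ : Measure ℝ) : Prop :=
  ∀ k : ℕ, Integrable (fun x : ℝ => x ^ k) μ

/-- The set of moment sequences of the admissible measures supported on `K`.
A measure is supported on `K` (in the applications, a closed set) if it does not charge the
complement of `K`. -/
def momentSequences (K : Set ℝ) : Set (ℕ → ℝ) :=
  {s | ∃ μ : Measure ℝ, IsAdmissible μ ∧ μ Kᶜ = 0 ∧ ∀ k : ℕ, s k = ∫ x, x ^ k ∂μ}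

/-- `F` is the restriction to the real line of an absolutely monotonic entire function, that is,
of an entire function whose Taylor coefficients at every point of `(0, ∞)` are non-negative
(in `ℂ`, `0 ≤ z` means that `z` is real and non-negative). -/
def IsRestrictionOfAbsMonotonicEntire (F : ℝ → ℝ) : Prop :=
  ∃ G : ℂ → ℂ, Differentiable ℂ G ∧
    (∀ x : ℝ, 0 < x → ∀ n : ℕ, 0 ≤ iteratedDeriv n G (x : ℂ) / (n.factorial : ℂ)) ∧
    ∀ x : ℝ, (F x : ℂ) = G (x : ℂ)

/-- The semi-infinite Hankel matrix with first column `s`. -/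
def hankelMatrix (s : ℕ → ℝ) : Matrix ℕ ℕ ℝ :=
  Matrix.of fun i j => s (i + j)

/-! The hard implication extracts everything from the sequences `F (a * (-1) ^ k + b * u ^ k + c)`,
which are bounded and positive semidefinite. For such a sequence `s` the Riesz functional is also
nonnegative on `(1 - X ^ 2) * q ^ 2`, so `|s 1| ≤ s 0` and `s k - s (k + 2)` is again bounded and
positive semidefinite. With `u = exp (-h)`, `b = exp y`, `c = 0`, iterating this compares the
differences of all orders of `f x = F (a + exp x)` and `g x = F (-a + exp x)`; as `h → 0`, both `f +
g` and `f - g` have nonnegative differences. Bernstein's argument makes them real analytic, hence so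
is `g`, and `F` is analytic on `(-a, ∞)` for every `a ≥ 0`. Masses at `u` and `1` alone then give
`F^(m) ≥ 0` on `[0, ∞)`, by testing against a squared polynomial that kills the lower Taylor terms
(`iteratedDeriv_nonneg`). The Taylor series at `0` therefore converges everywhere, and the identity
theorem identifies it with `F`. Conversely, if `F x = ∑ c n * x ^ n` with `c n ≥ 0`, then `∑ c n •
mconvPow μ n` represents `F[s]`, and the Schur product theorem handles matrices. -/

/-! ### Bounded positive semidefinite sequences. -/

section MomentFunctional

open Polynomial

/-- The Riesz functional of a sequence: the linear functional on real polynomials that maps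
`X ^ k` to `s k`. -/
noncomputable def rieszFunctional (s : ℕ → ℝ) : ℝ[X] →ₗ[ℝ] ℝ :=
  Polynomial.lsum fun k => s k • LinearMap.id

lemma rieszFunctional_apply (s : ℕ → ℝ) (p : ℝ[X]) :
    rieszFunctional s p = p.sum fun k c => s k * c := by
  simp [rieszFunctional, Polynomial.lsum_apply]

@[simp]
lemma rieszFunctional_monomial (s : ℕ → ℝ) (k : ℕ) (c : ℝ) :
    rieszFunctional s (monomial k c) = s k * c := by
  rw [rieszFunctional_apply, Polynomial.sum_monomial_index _ _ (by simp)]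

@[simp]
lemma rieszFunctional_X_pow (s : ℕ → ℝ) (k : ℕ) : rieszFunctional s (X ^ k) = s k := by
  rw [X_pow_eq_monomial, rieszFunctional_monomial, mul_one]

lemma rieszFunctional_one (s : ℕ → ℝ) : rieszFunctional s 1 = s 0 := by
  simpa using rieszFunctional_X_pow s 0

lemma rieszFunctional_X (s : ℕ → ℝ) : rieszFunctional s X = s 1 := by
  simpa using rieszFunctional_X_pow s 1

lemma rieszFunctional_X_pow_mul (s : ℕ → ℝ) (j : ℕ) (p : ℝ[X]) :
    rieszFunctional s (X ^ j * p) = rieszFunctional (fun k => s (k + j)) p := by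
  induction p using Polynomial.induction_on' with
  | add p q hp hq => rw [mul_add, map_add, map_add, hp, hq]
  | monomial n a => rw [X_pow_mul_monomial, rieszFunctional_monomial, rieszFunctional_monomial]

lemma rieszFunctional_sub (s t : ℕ → ℝ) (p : ℝ[X]) :
    rieszFunctional (fun k => s k - t k) p = rieszFunctional s p - rieszFunctional t p := by
  induction p using Polynomial.induction_on' with
  | add p q hp hq => rw [map_add, map_add, map_add, hp, hq]; ring
  | monomial n a => simp only [rieszFunctional_monomial]; ring

lemma rieszFunctional_sub_shift (s : ℕ → ℝ) (j : ℕ) (p : ℝ[X]) :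
    rieszFunctional (fun k => s k - s (k + j)) p = rieszFunctional s ((1 - X ^ j) * p) := by
  rw [rieszFunctional_sub, sub_mul, one_mul, map_sub, rieszFunctional_X_pow_mul]

/-- A sequence is positive semidefinite if its Riesz functional is nonnegative on squares. -/
def IsPosSemidefSeq (s : ℕ → ℝ) : Prop :=
  ∀ q : ℝ[X], 0 ≤ rieszFunctional s (q * q)

lemma exists_bound_rieszFunctional {s : ℕ → ℝ} (hs : ∃ C, ∀ k, |s k| ≤ C) (p : ℝ[X]) :
    ∃ C, ∀ k, |rieszFunctional s (X ^ k * p)| ≤ C := by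
  induction p using Polynomial.induction_on' with
  | add p q hp hq =>
    obtain ⟨C, hC⟩ := hp
    obtain ⟨D, hD⟩ := hq
    refine ⟨C + D, fun k => ?_⟩
    rw [mul_add, map_add]
    exact (abs_add_le _ _).trans (add_le_add (hC k) (hD k))
  | monomial n a =>
    obtain ⟨C, hC⟩ := hs
    refine ⟨C * |a|, fun k => ?_⟩
    rw [X_pow_mul_monomial, rieszFunctional_monomial, abs_mul]
    exact mul_le_mul_of_nonneg_right (hC _) (abs_nonneg a)

/-- A convex sequence with a positive first increment grows at least linearly. -/
lemma le_of_convex_of_bounded {a : ℕ → ℝ} (hconv : ∀ m, 2 * a (m + 1) ≤ a m + a (m + 2))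
    {C : ℝ} (hC : ∀ m, a m ≤ C) : a 1 ≤ a 0 := by
  by_contra! h
  have step : ∀ m : ℕ, a 1 - a 0 ≤ a (m + 1) - a m := by
    intro m
    induction m with
    | zero => simp
    | succ m ih => linarith [hconv m]
  have lower : ∀ m : ℕ, a 0 + m * (a 1 - a 0) ≤ a m := by
    intro m
    induction m with
    | zero => simp
    | succ m ih => push_cast; linarith [step m]
  obtain ⟨m, hm⟩ := exists_nat_gt ((C - a 0) / (a 1 - a 0))
  rw [div_lt_iff₀ (by linarith)] at hm
  linarith [lower m, hC m]

namespace IsPosSemidefSeq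

variable {s : ℕ → ℝ}

/-- Positivity on `((X ^ m - X ^ (m + 2)) * q) ^ 2` says that the value at `X ^ (2 * m) * q ^ 2` is
convex in `m`. Being bounded, it cannot increase from `m = 0` to `m = 1`. This replaces knowing that
a representing measure lives on `[-1, 1]`. -/
lemma one_sub_X_sq_mul (hs : IsPosSemidefSeq s) (hb : ∃ C, ∀ k, |s k| ≤ C) (q : ℝ[X]) :
    0 ≤ rieszFunctional s ((1 - X ^ 2) * (q * q)) := by
  obtain ⟨C, hC⟩ := exists_bound_rieszFunctional hb (q * q)
  have := le_of_convex_of_bounded (a := fun m => rieszFunctional s (X ^ (2 * m) * (q * q)))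
    (fun m => ?_) (C := C) (fun m => (le_abs_self _).trans (hC _))
  · simp only [mul_one, mul_zero, pow_zero, one_mul] at this
    rw [sub_mul, one_mul, map_sub]
    linarith
  · have h := hs (X ^ m * q - X ^ (m + 2) * q)
    have e : (X ^ m * q - X ^ (m + 2) * q) * (X ^ m * q - X ^ (m + 2) * q) =
        X ^ (2 * m) * (q * q) + X ^ (2 * (m + 2)) * (q * q)
          - (2 : ℝ) • (X ^ (2 * (m + 1)) * (q * q)) := by
      rw [two_smul]; ring
    rw [e, map_sub, map_add, map_smul, smul_eq_mul] at h
    linarith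

/-- Follows from `2 * (1 + X) = (1 + X) ^ 2 + (1 - X ^ 2)`. -/
lemma one_add_X_mul (hs : IsPosSemidefSeq s) (hb : ∃ C, ∀ k, |s k| ≤ C) (q : ℝ[X]) :
    0 ≤ rieszFunctional s ((1 + X) * (q * q)) := by
  have h := add_nonneg (hs ((1 + X) * q)) (hs.one_sub_X_sq_mul hb q)
  have e : (1 + X) * q * ((1 + X) * q) + (1 - X ^ 2) * (q * q) =
      (2 : ℝ) • ((1 + X) * (q * q)) := by
    rw [two_smul]; ring
  rw [← map_add, e, map_smul, smul_eq_mul] at h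
  linarith

lemma one_sub_X_mul (hs : IsPosSemidefSeq s) (hb : ∃ C, ∀ k, |s k| ≤ C) (q : ℝ[X]) :
    0 ≤ rieszFunctional s ((1 - X) * (q * q)) := by
  have h := add_nonneg (hs ((1 - X) * q)) (hs.one_sub_X_sq_mul hb q)
  have e : (1 - X) * q * ((1 - X) * q) + (1 - X ^ 2) * (q * q) =
      (2 : ℝ) • ((1 - X) * (q * q)) := by
    rw [two_smul]; ring
  rw [← map_add, e, map_smul, smul_eq_mul] at h
  linarith

lemma sub_shift_two (hs : IsPosSemidefSeq s) (hb : ∃ C, ∀ k, |s k| ≤ C) :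
    IsPosSemidefSeq fun k => s k - s (k + 2) := fun q => by
  rw [rieszFunctional_sub_shift]
  exact hs.one_sub_X_sq_mul hb q

lemma abs_one_le_zero (hs : IsPosSemidefSeq s) (hb : ∃ C, ∀ k, |s k| ≤ C) : |s 1| ≤ s 0 := by
  have h1 := hs.one_add_X_mul hb 1
  have h2 := hs.one_sub_X_mul hb 1
  simp only [mul_one, map_add, map_sub, rieszFunctional_one, rieszFunctional_X] at h1 h2
  rw [abs_le]
  constructor <;> linarith

end IsPosSemidefSeq

lemma exists_bound_sub_shift {s : ℕ → ℝ} (hb : ∃ C, ∀ k, |s k| ≤ C) (j : ℕ) :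
    ∃ C, ∀ k, |s k - s (k + j)| ≤ C := by
  obtain ⟨C, hC⟩ := hb
  exact ⟨C + C, fun k => (abs_sub _ _).trans (add_le_add (hC _) (hC _))⟩

end MomentFunctional

/-! ### Bernstein's theorem: nonnegative differences imply analyticity. -/

section AbsolutelyMonotone

open Filter Topology Set
open scoped fwdDiff ContDiff

/-- A difference with step `m * h` telescopes into a sum of translated differences with step `h`. -/
lemma fwdDiff_iter_mul_nonneg {f : ℝ → ℝ} {h : ℝ} {n : ℕ}
    (hf : ∀ y, 0 ≤ (fwdDiff h)^[n] f y) (m : ℕ) :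
    ∀ y, 0 ≤ (fwdDiff (m * h))^[n] f y := by
  induction n generalizing f with
  | zero => exact hf
  | succ n ih =>
    have e : fwdDiff (m * h) f = ∑ j ∈ Finset.range m, fun x => fwdDiff h f (x + j * h) := by
      funext x
      have := Finset.sum_range_sub (fun j : ℕ => f (x + j * h)) m
      simp only [Nat.cast_zero, zero_mul, add_zero] at this
      rw [fwdDiff, ← this, Finset.sum_apply]
      refine Finset.sum_congr rfl fun j _ => ?_
      rw [fwdDiff]
      push_cast
      ring_nf
    rw [Function.iterate_succ_apply]
    refine ih fun y => ?_
    rw [e, fwdDiff_iter_finsetSum, Finset.sum_apply]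
    refine Finset.sum_nonneg fun j _ => ?_
    rw [fwdDiff_iter_comp_add h (fwdDiff h f) (j * h) n y, ← Function.iterate_succ_apply]
    exact hf _

/-- All iterated forward differences of `g` are nonnegative. -/
def HasNonnegDifferences (g : ℝ → ℝ) : Prop :=
  ∀ h : ℝ, 0 < h → ∀ (n : ℕ) (y : ℝ), 0 ≤ (fwdDiff h)^[n] g y

lemma tendsto_fwdDiff_iter {ι : Type*} {l : Filter ι} {f : ι → ℝ → ℝ} {g : ℝ → ℝ}
    (hf : ∀ x, Tendsto (fun i => f i x) l (𝓝 (g x))) (h : ℝ) (n : ℕ) (y : ℝ) :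
    Tendsto (fun i => (fwdDiff h)^[n] (f i) y) l (𝓝 ((fwdDiff h)^[n] g y)) := by
  simp only [fwdDiff_iter_eq_sum_shift]
  exact tendsto_finsetSum _ fun k _ => (hf _).const_smul _

/-- Monotonicity bounds the convexity defect by `g y - g x`; each midpoint step halves this bound.
-/
lemma convexOn_of_midpoint_of_monotone {g : ℝ → ℝ}
    (hmid : ∀ x y, g ((x + y) / 2) ≤ (g x + g y) / 2) (hmono : Monotone g) :
    ConvexOn ℝ univ g := by
  suffices H : ∀ x y, x ≤ y → ∀ t ∈ Icc (0 : ℝ) 1, g (x + t * (y - x)) ≤ g x + t * (g y - g x) by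
    refine LinearOrder.convexOn_of_lt convex_univ fun x _ y _ hxy a b ha hb hab => ?_
    have := H x y hxy.le b ⟨hb.le, by linarith⟩
    obtain rfl : a = 1 - b := by linarith
    simp only [smul_eq_mul]
    calc g ((1 - b) * x + b * y) = g (x + b * (y - x)) := by ring_nf
      _ ≤ _ := this
      _ = _ := by ring
  intro x y hxy
  have key : ∀ n : ℕ, ∀ t ∈ Icc (0 : ℝ) 1,
      g (x + t * (y - x)) - (g x + t * (g y - g x)) ≤ (g y - g x) * (1 / 2) ^ n := by
    intro n
    induction n with
    | zero =>
      rintro t ⟨ht0, ht1⟩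
      have h1 : g (x + t * (y - x)) ≤ g y := hmono (by nlinarith)
      have h2 : g x ≤ g y := hmono hxy
      nlinarith
    | succ n ih =>
      rintro t ⟨ht0, ht1⟩
      rcases le_total t (1 / 2) with ht | ht
      · have h1 := ih (2 * t) ⟨by linarith, by linarith⟩
        have h2 := hmid x (x + 2 * t * (y - x))
        rw [show (x + (x + 2 * t * (y - x))) / 2 = x + t * (y - x) by ring] at h2
        rw [pow_succ]
        linarith
      · have h1 := ih (2 * t - 1) ⟨by linarith, by linarith⟩
        have h2 := hmid y (x + (2 * t - 1) * (y - x))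
        rw [show (y + (x + (2 * t - 1) * (y - x))) / 2 = x + t * (y - x) by ring] at h2
        rw [pow_succ]
        linarith
  intro t ht
  have hlim : Tendsto (fun n : ℕ => (g y - g x) * (1 / 2 : ℝ) ^ n) atTop (𝓝 0) := by
    simpa using (tendsto_pow_atTop_nhds_zero_of_lt_one (r := (1 / 2 : ℝ))
      (by norm_num) (by norm_num)).const_mul (g y - g x)
  have := ge_of_tendsto' hlim fun n => key n t ht
  linarith

namespace HasNonnegDifferences

variable {g : ℝ → ℝ}

lemma nonneg (hg : HasNonnegDifferences g) (x : ℝ) : 0 ≤ g x := hg 1 one_pos 0 x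

lemma monotone (hg : HasNonnegDifferences g) : Monotone g := by
  intro x y hxy
  rcases hxy.eq_or_lt with rfl | hlt
  · rfl
  · have := hg (y - x) (sub_pos.2 hlt) 1 x
    simpa [fwdDiff] using this

lemma convexOn (hg : HasNonnegDifferences g) : ConvexOn ℝ univ g := by
  refine convexOn_of_midpoint_of_monotone (fun x y => ?_) hg.monotone
  wlog hxy : x ≤ y generalizing x y
  · simpa only [add_comm] using this y x (le_of_not_ge hxy)
  rcases hxy.eq_or_lt with rfl | hlt
  · ring_nf; rfl
  · have := hg ((y - x) / 2) (by linarith) 2 x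
    simp only [Function.iterate_succ, Function.iterate_zero, Function.comp_apply, fwdDiff,
      id] at this
    rw [show x + (y - x) / 2 + (y - x) / 2 = y by ring,
      show x + (y - x) / 2 = (x + y) / 2 by ring] at this
    linarith

lemma continuous (hg : HasNonnegDifferences g) : Continuous g :=
  continuousOn_univ.1 (hg.convexOn.continuousOn isOpen_univ)

lemma hasDerivWithinAt (hg : HasNonnegDifferences g) (x : ℝ) :
    HasDerivWithinAt g (derivWithin g (Ioi x) x) (Ioi x) x :=
  hg.convexOn.hasDerivWithinAt_rightDeriv_of_mem_interior (by simp)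

lemma rightDeriv (hg : HasNonnegDifferences g) :
    HasNonnegDifferences fun x => derivWithin g (Ioi x) x := by
  intro h hh n y
  -- The quotients use steps `h / (m + 1)`, of which `h` is an integer multiple, so
  -- `fwdDiff_iter_mul_nonneg` applies to them.
  have hlim : ∀ x, Tendsto (fun m : ℕ => ((m + 1 : ℕ) / h : ℝ) • fwdDiff (h / (m + 1 : ℕ)) g x)
      atTop (𝓝 (derivWithin g (Ioi x) x)) := by
    intro x
    have h1 := hasDerivWithinAt_iff_tendsto_slope.1 (hg.hasDerivWithinAt x)
    rw [show Ioi x \ {x} = Ioi x by simp] at h1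
    have h2 : Tendsto (fun m : ℕ => x + h / (m + 1 : ℕ)) atTop (𝓝[>] x) := by
      refine tendsto_nhdsWithin_iff.2 ⟨?_, Eventually.of_forall fun m => ?_⟩
      · have := ((tendsto_const_div_atTop_nhds_zero_nat h).comp
          (tendsto_add_atTop_nat 1)).const_add x
        simpa using this
      · simp only [mem_Ioi, lt_add_iff_pos_right]
        positivity
    refine (h1.comp h2).congr fun m => ?_
    simp only [Function.comp_apply, slope, fwdDiff, vsub_eq_sub, add_sub_cancel_left, inv_div]
  refine ge_of_tendsto' (tendsto_fwdDiff_iter hlim h n y) fun m => ?_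
  have h3 : 0 ≤ (fwdDiff h)^[n] (fwdDiff (h / (m + 1 : ℕ)) g) y := by
    have := fwdDiff_iter_mul_nonneg (f := fwdDiff (h / (m + 1 : ℕ)) g) (h := h / (m + 1 : ℕ))
      (n := n)
      (fun y => by rw [← Function.iterate_succ_apply]; exact hg _ (by positivity) _ _) (m + 1) y
    rwa [mul_div_cancel₀ _ (by positivity)] at this
  have h4 := fwdDiff_iter_const_smul h ((m + 1 : ℕ) / h : ℝ) (fwdDiff (h / (m + 1 : ℕ)) g) n
  have h5 := congrFun h4 y
  simp only [Pi.smul_apply, smul_eq_mul] at h5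
  have h6 : (fwdDiff h)^[n] (fun x => ((m + 1 : ℕ) / h : ℝ) • fwdDiff (h / (m + 1 : ℕ)) g x) y =
    ((m + 1 : ℕ) / h : ℝ) * (fwdDiff h)^[n] (fwdDiff (h / (m + 1 : ℕ)) g) y := h5
  rw [h6]
  positivity

/-- The right derivative has nonnegative differences too, hence is continuous, and `g` is its
primitive. -/
lemma hasDerivAt (hg : HasNonnegDifferences g) (x : ℝ) :
    HasDerivAt g (derivWithin g (Ioi x) x) x := by
  set d : ℝ → ℝ := fun x => derivWithin g (Ioi x) x with hd
  have hdc : Continuous d := hg.rightDeriv.continuous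
  have hF : ∀ t, HasDerivAt (fun t => ∫ u in (0 : ℝ)..t, d u) (d t) t := fun t =>
    hdc.integral_hasStrictDerivAt 0 t |>.hasDerivAt
  have heq : ∀ t, g t = (∫ u in (0 : ℝ)..t, d u) + g 0 := by
    intro t
    have := intervalIntegral.integral_eq_sub_of_hasDeriv_right (a := 0) (b := t) (f := g) (f' := d)
      hg.continuous.continuousOn (fun x _ => hg.hasDerivWithinAt x) (hdc.intervalIntegrable _ _)
    rw [this]; ring
  exact ((hF x).add_const (g 0)).congr_of_eventuallyEq (Eventually.of_forall heq)

lemma differentiable (hg : HasNonnegDifferences g) : Differentiable ℝ g :=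
  fun x => (hg.hasDerivAt x).differentiableAt

lemma deriv (hg : HasNonnegDifferences g) : HasNonnegDifferences (_root_.deriv g) := by
  rw [show _root_.deriv g = fun x => derivWithin g (Ioi x) x from
    funext fun x => (hg.hasDerivAt x).deriv]
  exact hg.rightDeriv

lemma iteratedDeriv (hg : HasNonnegDifferences g) (n : ℕ) :
    HasNonnegDifferences (_root_.iteratedDeriv n g) := by
  induction n with
  | zero => simpa
  | succ n ih => rw [iteratedDeriv_succ]; exact ih.deriv

lemma contDiff (hg : HasNonnegDifferences g) : ContDiff ℝ ∞ g :=
  contDiff_of_differentiable_iteratedDeriv fun n _ => (hg.iteratedDeriv n).differentiable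

end HasNonnegDifferences

lemma exists_taylor_lagrange {f : ℝ → ℝ} (hf : ContDiff ℝ ∞ f) {x₀ x : ℝ} (hx : x₀ ≠ x) (n : ℕ) :
    ∃ ξ ∈ uIoo x₀ x, f x = (∑ k ∈ Finset.range (n + 1),
      iteratedDeriv k f x₀ / (k.factorial : ℝ) * (x - x₀) ^ k) +
      iteratedDeriv (n + 1) f ξ / ((n + 1).factorial : ℝ) * (x - x₀) ^ (n + 1) := by
  obtain ⟨ξ, hξ, h⟩ := taylor_mean_remainder_lagrange_iteratedDeriv (n := n) hx
    (hf.of_le (by exact_mod_cast le_top)).contDiffOn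
  refine ⟨ξ, hξ, ?_⟩
  rw [sub_eq_iff_eq_add'] at h
  rw [h, taylor_within_apply]
  congr 1
  · refine Finset.sum_congr rfl fun k _ => ?_
    rw [iteratedDerivWithin_eq_iteratedDeriv (uniqueDiffOn_uIcc hx)
      (hf.of_le (by exact_mod_cast le_top)).contDiffAt left_mem_uIcc, smul_eq_mul]
    ring
  · ring

lemma taylor_sum_le {f : ℝ → ℝ} (hf : ContDiff ℝ ∞ f) {a b : ℝ} (hab : a < b)
    (hpos : ∀ (n : ℕ), ∀ y ∈ Icc a b, 0 ≤ iteratedDeriv n f y) (n : ℕ) :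
    ∑ k ∈ Finset.range n, iteratedDeriv k f a / (k.factorial : ℝ) * (b - a) ^ k ≤ f b := by
  have hba : 0 ≤ b - a := (sub_pos.2 hab).le
  obtain ⟨ξ, hξ, h⟩ := exists_taylor_lagrange hf hab.ne n
  rw [uIoo_of_le hab.le] at hξ
  have h0 := hpos (n + 1) ξ (Ioo_subset_Icc_self hξ)
  have h1 := hpos n a (left_mem_Icc.2 hab.le)
  rw [Finset.sum_range_succ] at h
  have h2 : 0 ≤ iteratedDeriv n f a / (n.factorial : ℝ) * (b - a) ^ n := by positivity
  have h3 : 0 ≤ iteratedDeriv (n + 1) f ξ / ((n + 1).factorial : ℝ) * (b - a) ^ (n + 1) := by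
    positivity
  linarith

lemma taylor_term_le {f : ℝ → ℝ} (hf : ContDiff ℝ ∞ f) {a b : ℝ} (hab : a < b)
    (hpos : ∀ (n : ℕ), ∀ y ∈ Icc a b, 0 ≤ iteratedDeriv n f y) (n : ℕ) :
    iteratedDeriv n f a / (n.factorial : ℝ) * (b - a) ^ n ≤ f b := by
  refine le_trans ?_ (taylor_sum_le hf hab hpos (n + 1))
  refine Finset.single_le_sum
    (f := fun k => iteratedDeriv k f a / (k.factorial : ℝ) * (b - a) ^ k) (fun k _ => ?_)
    (Finset.self_mem_range_succ n)
  have h0 := hpos k a (left_mem_Icc.2 hab.le)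
  have hba : 0 ≤ b - a := (sub_pos.2 hab).le
  positivity

/-- Nonnegative derivatives bound each Taylor coefficient at `y` by `g (y + 1)`. So the series at
`x` converges on the unit ball, with Lagrange remainder at most `g (x + 2) * |y| ^ (n + 1)`, also
for negative increments `y`. -/
lemma HasNonnegDifferences.analyticAt {g : ℝ → ℝ} (hg : HasNonnegDifferences g) (x : ℝ) :
    AnalyticAt ℝ g x := by
  have hpos : ∀ (n : ℕ) (y : ℝ), 0 ≤ _root_.iteratedDeriv n g y :=
    fun n => (hg.iteratedDeriv n).nonneg
  have hcoef : ∀ (n : ℕ) (y : ℝ), _root_.iteratedDeriv n g y / (n.factorial : ℝ) ≤ g (y + 1) := by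
    intro n y
    simpa using taylor_term_le hg.contDiff (lt_add_one y) (fun n y _ => hpos n y) n
  set c : ℕ → ℝ := fun n => _root_.iteratedDeriv n g x / (n.factorial : ℝ) with hc
  have hc0 : ∀ n, 0 ≤ c n := fun n => div_nonneg (hpos n x) (by positivity)
  have hball : HasFPowerSeriesOnBall g (FormalMultilinearSeries.ofScalars ℝ c) x 1 := by
    refine ⟨?_, one_pos, ?_⟩
    · refine FormalMultilinearSeries.le_radius_of_bound (r := 1) _ (g (x + 1)) fun n => ?_
      simp only [NNReal.coe_one, one_pow, mul_one]
      rw [FormalMultilinearSeries.ofScalars_norm, Real.norm_of_nonneg (hc0 n)]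
      exact hcoef n x
    · intro y hy
      have hy1 : |y| < 1 := by simpa [edist_dist] using hy
      simp only [FormalMultilinearSeries.ofScalars_apply_eq, smul_eq_mul]
      have hgeo : Summable fun n : ℕ => g (x + 1) * |y| ^ n :=
        (summable_geometric_of_lt_one (abs_nonneg y) hy1).mul_left _
      have hsum : Summable fun n : ℕ => ‖c n * y ^ n‖ := by
        refine Summable.of_nonneg_of_le (fun n => norm_nonneg _) (fun n => ?_) hgeo
        rw [norm_mul, norm_pow, Real.norm_of_nonneg (hc0 n), Real.norm_eq_abs]
        exact mul_le_mul_of_nonneg_right (hcoef n x) (by positivity)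
      rw [hasSum_iff_tendsto_nat_of_summable_norm hsum, ← tendsto_add_atTop_iff_nat 1,
        tendsto_iff_norm_sub_tendsto_zero]
      have hlim : Tendsto (fun n : ℕ => g (x + 1 + 1) * |y| ^ (n + 1)) atTop (𝓝 0) := by
        simpa using ((tendsto_pow_atTop_nhds_zero_of_lt_one (abs_nonneg y) hy1).comp
          (tendsto_add_atTop_nat 1)).const_mul (g (x + 1 + 1))
      refine squeeze_zero (fun n => norm_nonneg _) (fun n => ?_) hlim
      rcases eq_or_ne y 0 with rfl | hy0
      · rw [Finset.sum_eq_single 0] <;> simp +contextual [c]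
      obtain ⟨ξ, hξ, h⟩ := exists_taylor_lagrange hg.contDiff (x₀ := x) (x := x + y)
        (by simpa using hy0) n
      rw [add_sub_cancel_left] at h
      rw [h, sub_add_cancel_left, norm_neg, norm_mul, norm_pow, Real.norm_eq_abs y,
        Real.norm_of_nonneg (div_nonneg (hpos _ _) (by positivity))]
      refine mul_le_mul_of_nonneg_right ?_ (by positivity)
      have hξ1 : ξ ≤ x + 1 := by
        have := hξ.2.le
        have h4 := (abs_lt.1 hy1).2
        rcases le_total x (x + y) with h' | h' <;>
          simp only [sup_of_le_right, sup_of_le_left, h'] at this <;> linarith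
      exact (hcoef (n + 1) ξ).trans (hg.monotone (by linarith))
  exact hball.analyticAt

end AbsolutelyMonotone

/-! ### From three-point moments to analyticity and nonnegative derivatives. -/

section SchoenbergCore

open Filter Topology Set
open scoped ContDiff

/-- `F` is given on the whole real line by a power series with nonnegative coefficients. -/
def HasNonnegPowerSeries (F : ℝ → ℝ) : Prop :=
  ∃ c : ℕ → ℝ, (∀ n, 0 ≤ c n) ∧ ∀ x, HasSum (fun n => c n * x ^ n) (F x)

/-- The entrywise action of `F` sends the moment sequences of all nonnegative combinations of
point masses at `-1`, `u`, `1`, where `0 < u < 1`, to positive semidefinite sequences. -/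
def PreservesThreePointMoments (F : ℝ → ℝ) : Prop :=
  ∀ u ∈ Ioo (0 : ℝ) 1, ∀ a b c : ℝ, 0 ≤ a → 0 ≤ b → 0 ≤ c →
    IsPosSemidefSeq fun k => F (a * (-1) ^ k + b * u ^ k + c)

/-- Needs no boundedness, so it can be used to establish the bounds required elsewhere. -/
lemma IsPosSemidefSeq.two_mul_abs_le {s : ℕ → ℝ} (hs : IsPosSemidefSeq s) :
    2 * |s 1| ≤ s 0 + s 2 := by
  have h1 := hs (1 + Polynomial.X)
  have h2 := hs (1 - Polynomial.X)
  have e1 : (1 + Polynomial.X) * (1 + Polynomial.X) =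
      (1 + Polynomial.X + Polynomial.X + Polynomial.X ^ 2 : Polynomial ℝ) := by ring
  have e2 : (1 - Polynomial.X) * (1 - Polynomial.X) =
      (1 - Polynomial.X - Polynomial.X + Polynomial.X ^ 2 : Polynomial ℝ) := by ring
  rw [e1] at h1
  rw [e2] at h2
  simp only [map_add, map_sub, rieszFunctional_one, rieszFunctional_X, rieszFunctional_X_pow]
    at h1 h2
  rcases abs_cases (s 1) with ⟨h, _⟩ | ⟨h, _⟩ <;> rw [h] <;> linarith

/-- The sequence alternating between the values of `f` and `g` along `y, y - h, y - 2 * h, …`. -/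
noncomputable def alternatingSamples (f g : ℝ → ℝ) (h y : ℝ) (k : ℕ) : ℝ :=
  if Even k then f (y - k * h) else g (y - k * h)

/-- A step of `2 * h` preserves the parity of the index, so differencing `f` and `g` together
amounts to `s k - s (k + 2)`. -/
lemma alternatingSamples_fwdDiff (f g : ℝ → ℝ) (h y : ℝ) :
    alternatingSamples (fwdDiff (2 * h) f) (fwdDiff (2 * h) g) h y =
      fun k => alternatingSamples f g h (y + 2 * h) k -
        alternatingSamples f g h (y + 2 * h) (k + 2) := by
  funext k
  have e1 : y - k * h + 2 * h = y + 2 * h - k * h := by ring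
  have e2 : y - k * h = y + 2 * h - ((k + 2 : ℕ) : ℝ) * h := by push_cast; ring
  have e3 : Even (k + 2) ↔ Even k := by simp [Nat.even_add]
  simp only [alternatingSamples, fwdDiff, e1, e3]
  rw [e2]
  split_ifs <;> rfl

lemma isPosSemidefSeq_fwdDiff_iter {f g : ℝ → ℝ} {h : ℝ}
    (hfg : ∀ y, IsPosSemidefSeq (alternatingSamples f g h y) ∧
      ∃ C, ∀ k, |alternatingSamples f g h y k| ≤ C) (n : ℕ) (y : ℝ) :
    IsPosSemidefSeq (alternatingSamples ((fwdDiff (2 * h))^[n] f) ((fwdDiff (2 * h))^[n] g) h y) ∧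
      ∃ C, ∀ k, |alternatingSamples ((fwdDiff (2 * h))^[n] f) ((fwdDiff (2 * h))^[n] g) h y k|
        ≤ C := by
  induction n generalizing f g y with
  | zero => exact hfg y
  | succ n ih =>
    simp only [Function.iterate_succ_apply]
    refine ih (fun y => ?_) y
    rw [alternatingSamples_fwdDiff]
    exact ⟨(hfg _).1.sub_shift_two (hfg _).2, exists_bound_sub_shift (hfg _).2 2⟩

lemma abs_fwdDiff_iter_le {f g : ℝ → ℝ} {h : ℝ}
    (hfg : ∀ y, IsPosSemidefSeq (alternatingSamples f g h y) ∧
      ∃ C, ∀ k, |alternatingSamples f g h y k| ≤ C) (n : ℕ) (y : ℝ) :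
    |(fwdDiff (2 * h))^[n] g (y - h)| ≤ (fwdDiff (2 * h))^[n] f y := by
  have h1 := isPosSemidefSeq_fwdDiff_iter hfg n y
  simpa [alternatingSamples] using h1.1.abs_one_le_zero h1.2

/-- The comparison of `f` and `g` is off by a half step `d`. Cutting `h` into `m + 1` steps `2 * d`
and letting `d → 0` removes the shift; only `f` is shifted, so only its continuity is needed. -/
lemma hasNonnegDifferences_add_smul {f g : ℝ → ℝ}
    (hfg : ∀ h, 0 < h → ∀ y, IsPosSemidefSeq (alternatingSamples f g h y) ∧
      ∃ C, ∀ k, |alternatingSamples f g h y k| ≤ C)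
    {σ : ℝ} (hσ : |σ| ≤ 1) : HasNonnegDifferences fun x => f x + σ • g x := by
  have hf : HasNonnegDifferences f := by
    intro h hh n y
    have := (abs_nonneg _).trans (abs_fwdDiff_iter_le (hfg (h / 2) (by positivity)) n y)
    rwa [mul_div_cancel₀ h two_ne_zero] at this
  intro h hh n y
  have hlim : ∀ x, Tendsto (fun m : ℕ => f (x + h / (m + 1 : ℕ) / 2) + σ • g x) atTop
      (𝓝 (f x + σ • g x)) := by
    intro x
    refine ((hf.continuous.tendsto x).comp ?_).add_const _
    have := (((tendsto_const_div_atTop_nhds_zero_nat h).comp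
      (tendsto_add_atTop_nat 1)).div_const 2).const_add x
    simpa using this
  refine ge_of_tendsto' (tendsto_fwdDiff_iter hlim h n y) fun m => ?_
  set d : ℝ := h / (m + 1 : ℕ) / 2 with hd
  have hd0 : 0 < d := by positivity
  have h2d : ((m + 1 : ℕ) : ℝ) * (2 * d) = h := by
    rw [hd]; field_simp
  rw [← h2d]
  refine fwdDiff_iter_mul_nonneg (fun y => ?_) (m + 1) y
  have e : (fun x => f (x + d) + σ • g x) = (fun x => f (x + d)) + σ • g := rfl
  rw [e, fwdDiff_iter_add, Pi.add_apply, fwdDiff_iter_const_smul, fwdDiff_iter_comp_add,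
    Pi.smul_apply, smul_eq_mul]
  have key := abs_fwdDiff_iter_le (hfg d hd0) n (y + d)
  rw [add_sub_cancel_right] at key
  have : |σ * (fwdDiff (2 * d))^[n] g y| ≤ (fwdDiff (2 * d))^[n] f (y + d) := by
    rw [abs_mul]
    exact (mul_le_of_le_one_left (abs_nonneg _) hσ).trans key
  linarith [(abs_le.1 this).1]

namespace PreservesThreePointMoments

variable {F : ℝ → ℝ}

/-- Masses `(y - x) / 2` at `-1` and `(y + x) / 2` at `1` have moments `y, x, y, …`. -/
lemma abs_le_of_abs_le (hF : PreservesThreePointMoments F) {x y : ℝ} (hxy : |x| ≤ y) :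
    |F x| ≤ F y := by
  obtain ⟨h1, h2⟩ := abs_le.1 hxy
  have h := (hF (1 / 2) ⟨by norm_num, by norm_num⟩ ((y - x) / 2) 0 ((y + x) / 2)
    (by linarith) le_rfl (by linarith)).two_mul_abs_le
  simp only [pow_zero, pow_one, mul_one, zero_mul, add_zero, neg_one_sq] at h
  rw [show (y - x) / 2 * -1 + (y + x) / 2 = x by ring,
    show (y - x) / 2 + (y + x) / 2 = y by ring] at h
  linarith

lemma nonneg (hF : PreservesThreePointMoments F) {x : ℝ} (hx : 0 ≤ x) : 0 ≤ F x :=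
  (abs_nonneg _).trans (hF.abs_le_of_abs_le (abs_of_nonneg hx).le)

lemma alternatingSamples_exp (hF : PreservesThreePointMoments F) {a : ℝ} (ha : 0 ≤ a) {h : ℝ}
    (hh : 0 < h) (y : ℝ) :
    IsPosSemidefSeq (alternatingSamples (fun x => F (a + Real.exp x))
        (fun x => F (-a + Real.exp x)) h y) ∧
      ∃ C, ∀ k, |alternatingSamples (fun x => F (a + Real.exp x))
        (fun x => F (-a + Real.exp x)) h y k| ≤ C := by
  have e : alternatingSamples (fun x => F (a + Real.exp x)) (fun x => F (-a + Real.exp x)) h y =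
      fun k => F (a * (-1) ^ k + Real.exp y * Real.exp (-h) ^ k + 0) := by
    funext k
    have e1 : Real.exp (y - k * h) = Real.exp y * Real.exp (-h) ^ k := by
      rw [← Real.exp_nat_mul, ← Real.exp_add]; ring_nf
    rcases Nat.even_or_odd k with hk | hk
    · simp [alternatingSamples, hk, e1, hk.neg_one_pow]
    · simp [alternatingSamples, Nat.not_even_iff_odd.2 hk, e1, hk.neg_one_pow]
  rw [e]
  have hu1 : Real.exp (-h) < 1 := by simpa using hh
  refine ⟨hF _ ⟨Real.exp_pos _, hu1⟩ _ _ _ ha (Real.exp_pos _).le le_rfl,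
    F (a + Real.exp y), fun k => hF.abs_le_of_abs_le ?_⟩
  rw [add_zero]
  refine (abs_add_le _ _).trans (add_le_add ?_ ?_)
  · simp [abs_mul, abs_of_nonneg ha]
  · rw [abs_of_nonneg (by positivity)]
    exact mul_le_of_le_one_right (Real.exp_pos _).le (pow_le_one₀ (Real.exp_pos _).le hu1.le)

lemma analyticAt (hF : PreservesThreePointMoments F) (x : ℝ) : AnalyticAt ℝ F x := by
  -- Any `a ≥ 0` with `-a < x` would do: `x` must lie in the range of `-a + exp`.
  set a : ℝ := |x| + 1 with ha
  have ha0 : 0 ≤ a := by positivity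
  have hxa : 0 < x + a := by linarith [neg_abs_le x]
  have hP := hasNonnegDifferences_add_smul (fun h hh y => hF.alternatingSamples_exp ha0 hh y)
    (σ := 1) (by simp)
  have hM := hasNonnegDifferences_add_smul (fun h hh y => hF.alternatingSamples_exp ha0 hh y)
    (σ := -1) (by simp)
  have h1 : AnalyticAt ℝ (fun t => F (-a + Real.exp t)) (Real.log (x + a)) := by
    have := ((hP.analyticAt (Real.log (x + a))).sub (hM.analyticAt (Real.log (x + a)))).const_smul
      (c := (1 / 2 : ℝ))
    refine this.congr (Eventually.of_forall fun t => ?_)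
    simp only [Pi.smul_apply, Pi.sub_apply, smul_eq_mul]
    ring
  have h2 : AnalyticAt ℝ (fun t => Real.log (t + a)) x :=
    AnalyticAt.log (analyticAt_id.add analyticAt_const) hxa
  refine (h1.comp_of_eq h2 rfl).congr ?_
  filter_upwards [lt_mem_nhds (show -a < x by linarith)] with t ht
  rw [Function.comp_apply, Real.exp_log (by linarith), neg_add_eq_sub, add_sub_cancel_right]

lemma contDiff (hF : PreservesThreePointMoments F) {n : WithTop ℕ∞} : ContDiff ℝ n F :=
  AnalyticOnNhd.contDiff fun x _ => hF.analyticAt x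

lemma iteratedDeriv_nonneg (hF : PreservesThreePointMoments F) (m : ℕ) {a : ℝ} (ha : 0 ≤ a) :
    0 ≤ iteratedDeriv m F a := by
  rcases m with _ | m
  · simpa using hF.nonneg ha
  set u : ℝ := 1 / 2 with hu
  -- The `j`-th derivative at `0` of `Φ` below is `P (u ^ j) * F^(j) a`. The roots `u ^ 0, …, u ^ m`
  -- kill orders up to `m`, while `P (u ^ (m + 1)) > 0`.
  set q : Polynomial ℝ := ∏ j ∈ Finset.range (m + 1), (Polynomial.X - Polynomial.C (u ^ j)) with hq
  set P := q * q with hP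
  set Φ : ℝ → ℝ := fun b => ∑ k ∈ P.support, P.coeff k * F (a + u ^ k * b) with hΦ
  have hsmooth : ContDiff ℝ ∞ Φ := by
    have := hF.contDiff (n := ∞)
    fun_prop
  have hderiv : ∀ j b, iteratedDeriv j Φ b =
      ∑ k ∈ P.support, P.coeff k * ((u ^ k) ^ j * iteratedDeriv j F (a + u ^ k * b)) := by
    intro j b
    have hFj : ContDiff ℝ j F := hF.contDiff
    have hFa : ContDiff ℝ j (fun z => F (a + z)) := by fun_prop
    rw [hΦ, iteratedDeriv_fun_sum (fun k _ => by fun_prop)]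
    refine Finset.sum_congr rfl fun k _ => ?_
    rw [iteratedDeriv_const_mul_field, iteratedDeriv_comp_const_mul hFa]
    simp only [iteratedDeriv_comp_const_add]
  have hderiv0 : ∀ j, iteratedDeriv j Φ 0 = P.eval (u ^ j) * iteratedDeriv j F a := by
    intro j
    rw [hderiv, Polynomial.eval_eq_sum, Polynomial.sum, Finset.sum_mul]
    refine Finset.sum_congr rfl fun k _ => ?_
    rw [mul_zero, add_zero, ← pow_mul, ← pow_mul, mul_comm k j]
    ring
  have hvanish : ∀ j < m + 1, iteratedDeriv j Φ 0 = 0 := by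
    intro j hj
    rw [hderiv0, hP, Polynomial.eval_mul, hq, Polynomial.eval_prod,
      Finset.prod_eq_zero (Finset.mem_range.2 hj) (by simp)]
    simp
  have hΦnonneg : ∀ b, 0 ≤ b → 0 ≤ Φ b := by
    intro b hb
    have := hF u ⟨by norm_num [hu], by norm_num [hu]⟩ 0 b a le_rfl hb ha q
    rw [rieszFunctional_apply, Polynomial.sum] at this
    refine this.trans_eq (Finset.sum_congr rfl fun k _ => ?_)
    rw [mul_comm]
    congr 2
    ring
  -- With all lower terms zero, `Φ b ≥ 0` equals its Lagrange remainder.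
  have hmid : ∀ b, 0 < b → ∃ ξ ∈ Ioo 0 b, 0 ≤ iteratedDeriv (m + 1) Φ ξ := by
    intro b hb
    obtain ⟨ξ, hξ, h⟩ := exists_taylor_lagrange hsmooth hb.ne m
    rw [uIoo_of_le hb.le] at hξ
    refine ⟨ξ, hξ, ?_⟩
    rw [Finset.sum_eq_zero (fun k hk => by rw [hvanish k (Finset.mem_range.1 hk)]; simp),
      zero_add, sub_zero] at h
    by_contra! hneg
    have : iteratedDeriv (m + 1) Φ ξ / ((m + 1).factorial : ℝ) * b ^ (m + 1) < 0 :=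
      mul_neg_of_neg_of_pos (div_neg_of_neg_of_pos hneg (by positivity)) (by positivity)
    linarith [hΦnonneg b hb.le]
  have hcont : Continuous (iteratedDeriv (m + 1) Φ) :=
    hsmooth.continuous_iteratedDeriv _ (by exact_mod_cast le_top)
  have hzero : 0 ≤ iteratedDeriv (m + 1) Φ 0 := by
    by_contra! hneg
    obtain ⟨ε, hε, hball⟩ := Metric.eventually_nhds_iff.1
      (hcont.continuousAt.eventually_lt continuousAt_const hneg)
    obtain ⟨ξ, hξ, h⟩ := hmid ε hε
    refine absurd (hball (y := ξ) ?_) (not_lt.2 h)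
    rw [Real.dist_eq, sub_zero, abs_of_pos hξ.1]
    exact hξ.2
  rw [hderiv0, hP, Polynomial.eval_mul] at hzero
  have hne : q.eval (u ^ (m + 1)) ≠ 0 := by
    rw [hq, Polynomial.eval_prod]
    refine Finset.prod_ne_zero_iff.2 fun j hj => ?_
    simp only [Polynomial.eval_sub, Polynomial.eval_X, Polynomial.eval_C]
    rw [sub_ne_zero]
    exact (pow_lt_pow_right_of_lt_one₀ (by norm_num [hu]) (by norm_num [hu])
      (Finset.mem_range.1 hj)).ne
  exact nonneg_of_mul_nonneg_right hzero (mul_self_pos.2 hne)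

end PreservesThreePointMoments

/-! ### Nonnegative power series and entire functions. -/

lemma hasFPowerSeriesOnBall_ofScalars {𝕜 : Type*} [RCLike 𝕜] {c : ℕ → ℝ}
    (hc : ∀ r : ℝ, 0 < r → ∃ C, ∀ n, |c n| * r ^ n ≤ C) :
    HasFPowerSeriesOnBall (FormalMultilinearSeries.ofScalars 𝕜 fun n => (c n : 𝕜)).sum
      (FormalMultilinearSeries.ofScalars 𝕜 fun n => (c n : 𝕜)) 0 ⊤ := by
  have hr : (FormalMultilinearSeries.ofScalars 𝕜 fun n => (c n : 𝕜)).radius = ⊤ := by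
    refine ENNReal.eq_top_of_forall_nnreal_le fun r => ?_
    obtain ⟨C, hC⟩ := hc (r + 1) (by positivity)
    refine FormalMultilinearSeries.le_radius_of_bound _ C fun n => ?_
    rw [FormalMultilinearSeries.ofScalars_norm, RCLike.norm_ofReal]
    refine le_trans ?_ (hC n)
    gcongr
    simp
  have := (FormalMultilinearSeries.ofScalars 𝕜 fun n => (c n : 𝕜)).hasFPowerSeriesOnBall
    (by rw [hr]; exact ENNReal.zero_lt_top)
  rwa [hr] at this

lemma hasSum_ofScalars {𝕜 : Type*} [RCLike 𝕜] {c : ℕ → ℝ}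
    (hc : ∀ r : ℝ, 0 < r → ∃ C, ∀ n, |c n| * r ^ n ≤ C) (z : 𝕜) :
    HasSum (fun n => (c n : 𝕜) * z ^ n)
      ((FormalMultilinearSeries.ofScalars 𝕜 fun n => (c n : 𝕜)).sum z) := by
  have := (hasFPowerSeriesOnBall_ofScalars (𝕜 := 𝕜) hc).hasSum (y := z) (by simp)
  simpa [FormalMultilinearSeries.ofScalars_apply_eq, mul_comm] using this

theorem PreservesThreePointMoments.hasNonnegPowerSeries {F : ℝ → ℝ}
    (hF : PreservesThreePointMoments F) : HasNonnegPowerSeries F := by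
  set c : ℕ → ℝ := fun n => iteratedDeriv n F 0 / (n.factorial : ℝ) with hc
  have hc0 : ∀ n, 0 ≤ c n := fun n =>
    div_nonneg (hF.iteratedDeriv_nonneg n le_rfl) (by positivity)
  have hgrow : ∀ r : ℝ, 0 < r → ∃ C, ∀ n, |c n| * r ^ n ≤ C := by
    refine fun r hr => ⟨F r, fun n => ?_⟩
    rw [abs_of_nonneg (hc0 n)]
    simpa using taylor_term_le hF.contDiff hr
      (fun n y hy => hF.iteratedDeriv_nonneg n hy.1) n
  refine ⟨c, hc0, fun x => ?_⟩
  have hS := hasFPowerSeriesOnBall_ofScalars (𝕜 := ℝ) hgrow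
  have hF0 : HasFPowerSeriesAt F (FormalMultilinearSeries.ofScalars ℝ c) 0 :=
    (hF.analyticAt 0).hasFPowerSeriesAt
  have heq : F = (FormalMultilinearSeries.ofScalars ℝ c).sum := by
    refine AnalyticOnNhd.eq_of_eventuallyEq (z₀ := (0 : ℝ)) (fun x _ => hF.analyticAt x)
      (fun x _ => hS.analyticAt_of_mem (by simp)) ?_
    filter_upwards [hF0.eventually_hasSum_sub] with x hx
    rw [sub_zero] at hx
    exact hx.tsum_eq.symm
  rw [heq]
  exact hasSum_ofScalars hgrow x

lemma HasNonnegPowerSeries.isRestrictionOfAbsMonotonicEntire {F : ℝ → ℝ}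
    (hF : HasNonnegPowerSeries F) : IsRestrictionOfAbsMonotonicEntire F := by
  obtain ⟨c, hc0, hsum⟩ := hF
  have hgrow : ∀ r : ℝ, 0 < r → ∃ C, ∀ n, |c n| * r ^ n ≤ C := by
    refine fun r hr => ⟨F r, fun n => ?_⟩
    rw [abs_of_nonneg (hc0 n)]
    exact le_hasSum (hsum r) n fun k _ => mul_nonneg (hc0 k) (by positivity)
  set p := FormalMultilinearSeries.ofScalars ℂ fun n => (c n : ℂ) with hp
  have hS : HasFPowerSeriesOnBall p.sum p 0 ⊤ := hasFPowerSeriesOnBall_ofScalars (𝕜 := ℂ) hgrow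
  have hdiff : Differentiable ℂ p.sum := fun z =>
    (hS.analyticAt_of_mem (by simp)).differentiableAt
  have hderiv0 : ∀ n, 0 ≤ iteratedDeriv n p.sum 0 := by
    intro n
    have h1 := (hdiff.analyticAt 0).hasFPowerSeriesAt.eq_formalMultilinearSeries
      hS.hasFPowerSeriesAt
    have h2 := congrFun (FormalMultilinearSeries.ofScalars_series_injective ℂ ℂ h1) n
    rw [div_eq_iff (by positivity)] at h2
    rw [h2]
    have := hc0 n
    positivity
  have hpos : ∀ (G : ℂ → ℂ), Differentiable ℂ G → (∀ n, 0 ≤ iteratedDeriv n G 0) →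
      ∀ x : ℝ, 0 < x → 0 ≤ G x := by
    intro G hG h0 x hx
    have h1 := Complex.hasSum_taylorSeries_of_entire hG 0 x
    refine h1.nonneg fun n => ?_
    have := h0 n
    have hx' : (0 : ℂ) ≤ x := by exact_mod_cast hx.le
    simp only [sub_zero, smul_eq_mul]
    positivity
  refine ⟨p.sum, hdiff, fun x hx n => div_nonneg ?_ (by positivity), fun x => ?_⟩
  · have hmain : ∀ (n : ℕ) (G : ℂ → ℂ), Differentiable ℂ G → (∀ n, 0 ≤ iteratedDeriv n G 0) →
        0 ≤ iteratedDeriv n G x := by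
      intro n
      induction n with
      | zero => exact fun G hG h0 => by simpa using hpos G hG h0 x hx
      | succ n ih =>
        intro G hG h0
        rw [iteratedDeriv_succ']
        refine ih _ hG.deriv fun k => ?_
        rw [← iteratedDeriv_succ']
        exact h0 (k + 1)
    exact hmain n _ hdiff hderiv0
  · refine HasSum.unique ?_ (hasSum_ofScalars (𝕜 := ℂ) hgrow (x : ℂ))
    simpa using Complex.hasSum_ofReal.2 (hsum x)

lemma IsRestrictionOfAbsMonotonicEntire.hasNonnegPowerSeries {F : ℝ → ℝ}
    (hF : IsRestrictionOfAbsMonotonicEntire F) : HasNonnegPowerSeries F := by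
  obtain ⟨G, hG, hpos, hFG⟩ := hF
  -- Positivity is assumed only at points of `(0, ∞)`; it passes to `0` by continuity.
  have h0 : ∀ n : ℕ, 0 ≤ iteratedDeriv n G 0 / (n.factorial : ℂ) := by
    intro n
    have hcont : Continuous fun x : ℝ => iteratedDeriv n G (x : ℂ) / (n.factorial : ℂ) :=
      (((hG.contDiff (n := n)).continuous_iteratedDeriv n le_rfl).comp
        Complex.continuous_ofReal).div_const _
    have h1 : Tendsto (fun x : ℝ => iteratedDeriv n G (x : ℂ) / (n.factorial : ℂ)) (𝓝[>] 0)
        (𝓝 (iteratedDeriv n G 0 / (n.factorial : ℂ))) := by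
      simpa using (hcont.tendsto 0).mono_left nhdsWithin_le_nhds
    exact ge_of_tendsto h1 (eventually_nhdsWithin_of_forall fun x hx => hpos x hx n)
  refine ⟨fun n => (iteratedDeriv n G 0 / (n.factorial : ℂ)).re,
    fun n => (Complex.nonneg_iff.1 (h0 n)).1, fun x => ?_⟩
  have h1 := Complex.hasSum_taylorSeries_of_entire hG 0 x
  rw [← hFG] at h1
  rw [← Complex.hasSum_ofReal]
  refine h1.congr_fun ?_
  intro n
  have : (((iteratedDeriv n G 0 / (n.factorial : ℂ)).re : ℝ) : ℂ) =
      iteratedDeriv n G 0 / (n.factorial : ℂ) :=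
    Complex.ext (by simp) (by simpa using (Complex.nonneg_iff.1 (h0 n)).2)
  push_cast [this]
  simp only [sub_zero, smul_eq_mul]
  ring

end SchoenbergCore

/-! ### Multiplicative convolution of measures and Schur powers of matrices. -/

section MultiplicativeConvolution

open Set

/-- The `n`-fold multiplicative convolution power of a measure on the real line. -/
noncomputable def mconvPow (μ : Measure ℝ) : ℕ → Measure ℝ
  | 0 => Measure.dirac 1
  | n + 1 => (mconvPow μ n).mconv μ

instance isFiniteMeasure_mconvPow (μ : Measure ℝ) [IsFiniteMeasure μ] (n : ℕ) :
    IsFiniteMeasure (mconvPow μ n) := by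
  induction n with
  | zero => exact inferInstanceAs (IsFiniteMeasure (Measure.dirac (1 : ℝ)))
  | succ n ih => exact inferInstanceAs (IsFiniteMeasure (Measure.map _ _))

lemma integral_pow_mconvPow (μ : Measure ℝ) [IsFiniteMeasure μ] (n k : ℕ) :
    ∫ x, x ^ k ∂(mconvPow μ n) = (∫ x, x ^ k ∂μ) ^ n := by
  induction n with
  | zero => simp [mconvPow]
  | succ n ih =>
    rw [mconvPow, Measure.mconv, integral_map (by fun_prop) (by fun_prop), pow_succ, ← ih,
      ← integral_prod_mul]
    simp only [mul_pow]

lemma ae_mem_Icc_mconvPow {μ : Measure ℝ} [IsFiniteMeasure μ]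
    (hμ : ∀ᵐ x ∂μ, x ∈ Icc (-1 : ℝ) 1) (n : ℕ) :
    ∀ᵐ x ∂(mconvPow μ n), x ∈ Icc (-1 : ℝ) 1 := by
  induction n with
  | zero => simp [mconvPow, ae_dirac_eq]
  | succ n ih =>
    rw [mconvPow, Measure.mconv,
      ae_map_iff (p := (· ∈ Icc (-1 : ℝ) 1)) (by fun_prop) measurableSet_Icc]
    filter_upwards [Measure.quasiMeasurePreserving_fst.ae ih,
      Measure.quasiMeasurePreserving_snd.ae hμ] with z h1 h2
    rw [mem_Icc, ← abs_le] at h1 h2 ⊢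
    rw [abs_mul]
    exact mul_le_one₀ h1 (abs_nonneg _) h2

lemma integrable_pow_of_ae_mem_Icc {μ : Measure ℝ} [IsFiniteMeasure μ]
    (hμ : ∀ᵐ x ∂μ, x ∈ Icc (-1 : ℝ) 1) (k : ℕ) : Integrable (fun x => x ^ k) μ := by
  refine Integrable.of_bound (by fun_prop) 1 ?_
  filter_upwards [hμ] with x hx
  rw [norm_pow, Real.norm_eq_abs]
  exact pow_le_one₀ (abs_nonneg _) (abs_le.2 hx)

lemma IsAdmissible.isFiniteMeasure {μ : Measure ℝ} (hμ : IsAdmissible μ) : IsFiniteMeasure μ := by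
  have h := hμ 0
  simp only [pow_zero] at h
  exact (integrable_const_iff_isFiniteMeasure one_ne_zero).1 h

lemma momentSequences_mono {K L : Set ℝ} (hKL : K ⊆ L) :
    momentSequences K ⊆ momentSequences L := by
  rintro s ⟨μ, hμ, hK, hs⟩
  exact ⟨μ, hμ, measure_mono_null (compl_subset_compl.2 hKL) hK, hs⟩

/-- Multiplicative convolution multiplies moments and preserves support in `[-1, 1]`; the total mass
of `ν` is `F (s 0)`, hence finite. -/
theorem HasNonnegPowerSeries.comp_mem_momentSequences {F : ℝ → ℝ} (hF : HasNonnegPowerSeries F)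
    {s : ℕ → ℝ} (hs : s ∈ momentSequences (Icc (-1) 1)) :
    (fun k => F (s k)) ∈ momentSequences univ := by
  obtain ⟨c, hc0, hsum⟩ := hF
  obtain ⟨μ, hμ, hK, hs⟩ := hs
  have := hμ.isFiniteMeasure
  have hae : ∀ᵐ x ∂μ, x ∈ Icc (-1 : ℝ) 1 := hK
  set ν : Measure ℝ := Measure.sum fun n => ENNReal.ofReal (c n) • mconvPow μ n with hν
  have hνae : ∀ᵐ x ∂ν, x ∈ Icc (-1 : ℝ) 1 := by
    rw [hν, Measure.ae_sum_iff]
    exact fun n => Measure.ae_smul_measure (ae_mem_Icc_mconvPow hae n) _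
  have hs0 : 0 ≤ s 0 := by
    rw [hs]
    exact integral_nonneg fun x => by simp
  have : IsFiniteMeasure ν := by
    refine ⟨?_⟩
    have hterm : ∀ n, (ENNReal.ofReal (c n) • mconvPow μ n) univ =
        ENNReal.ofReal (c n * s 0 ^ n) := by
      intro n
      have h1 := integral_pow_mconvPow μ n 0
      rw [← hs] at h1
      simp only [pow_zero, integral_const, smul_eq_mul, mul_one] at h1
      rw [Measure.smul_apply, smul_eq_mul, ENNReal.ofReal_mul (hc0 n), ← h1, ofReal_measureReal]
    rw [hν, Measure.sum_apply _ MeasurableSet.univ]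
    simp only [hterm]
    rw [← ENNReal.ofReal_tsum_of_nonneg (fun n => mul_nonneg (hc0 n) (pow_nonneg hs0 n))
      (hsum (s 0)).summable]
    exact ENNReal.ofReal_lt_top
  refine ⟨ν, integrable_pow_of_ae_mem_Icc hνae, by simp, fun k => ?_⟩
  refine (hsum (s k)).unique ?_
  refine (hasSum_integral_measure (integrable_pow_of_ae_mem_Icc hνae k)).congr_fun fun n => ?_
  rw [integral_smul_measure, integral_pow_mconvPow, ← hs, ENNReal.toReal_ofReal (hc0 n),
    smul_eq_mul]

lemma Matrix.PosSemidef.map_pow {ι : Type*} {A : Matrix ι ι ℝ} (hA : A.PosSemidef) (n : ℕ) :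
    (A.map fun x => x ^ n).PosSemidef := by
  induction n with
  | zero =>
    refine ⟨by ext; simp, fun x => ?_⟩
    simp only [pow_zero, Matrix.map_apply, mul_one, star_trivial]
    have : (x.sum fun _ xi => x.sum fun _ xj => xi * xj) =
        (x.sum fun _ xi => xi) * (x.sum fun _ xi => xi) := by
      simp only [Finsupp.sum, Finset.sum_mul_sum]
    rw [this]
    exact mul_self_nonneg _
  | succ n ih =>
    have : (A.map fun x => x ^ (n + 1)) = (A.map fun x => x ^ n).hadamard A := by
      ext i j
      simp [pow_succ]
    rw [this]
    exact ih.hadamard hA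

theorem HasNonnegPowerSeries.posSemidef_map {F : ℝ → ℝ} (hF : HasNonnegPowerSeries F)
    {ι : Type*} {A : Matrix ι ι ℝ} (hA : A.PosSemidef) : (A.map F).PosSemidef := by
  obtain ⟨c, hc0, hsum⟩ := hF
  refine ⟨hA.isHermitian.map F fun x => by simp, fun x => ?_⟩
  have hx : HasSum (fun n => c n * x.sum fun i xi => x.sum fun j xj =>
        star xi * (A.map fun t => t ^ n) i j * xj)
      (x.sum fun i xi => x.sum fun j xj => star xi * (A.map F) i j * xj) := by
    simp only [Finsupp.sum, Finset.mul_sum]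
    refine hasSum_sum fun i _ => hasSum_sum fun j _ => ?_
    refine (((hsum (A i j)).mul_left (star (x i))).mul_right (x j)).congr_fun fun n => ?_
    simp only [Matrix.map_apply]
    ring
  exact hx.nonneg fun n => mul_nonneg (hc0 n) ((hA.map_pow n).2 x)

end MultiplicativeConvolution

/-! ### Hankel matrices and moments of three-point measures. -/

section Hankel

open Polynomial Set

lemma rieszFunctional_sum_mul_sum (s : ℕ → ℝ) (x : ℕ →₀ ℝ) :
    rieszFunctional s ((∑ i ∈ x.support, monomial i (x i)) * ∑ i ∈ x.support, monomial i (x i)) =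
      x.sum fun i xi => x.sum fun j xj => star xi * hankelMatrix s i j * xj := by
  simp only [Finset.sum_mul_sum, map_sum, monomial_mul_monomial, rieszFunctional_monomial,
    Finsupp.sum, hankelMatrix, Matrix.of_apply, star_trivial]
  refine Finset.sum_congr rfl fun i _ => Finset.sum_congr rfl fun j _ => ?_
  ring

lemma posSemidef_hankelMatrix_iff {s : ℕ → ℝ} :
    (hankelMatrix s).PosSemidef ↔ IsPosSemidefSeq s := by
  constructor
  · intro h q
    have := h.2 (Finsupp.onFinset q.support q.coeff fun n hn => mem_support_iff.2 hn)
    rw [← rieszFunctional_sum_mul_sum] at this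
    have e : (Finsupp.onFinset q.support q.coeff fun n hn => mem_support_iff.2 hn).support =
        q.support := by
      ext; simp
    rw [e] at this
    simpa only [Finsupp.onFinset_apply, ← q.as_sum_support] using this
  · intro h
    refine ⟨by ext i j; simp [hankelMatrix, add_comm], fun x => ?_⟩
    rw [← rieszFunctional_sum_mul_sum]
    exact h _

lemma isPosSemidefSeq_of_mem_momentSequences {K : Set ℝ} {s : ℕ → ℝ}
    (hs : s ∈ momentSequences K) : IsPosSemidefSeq s := by
  obtain ⟨μ, hμ, -, hs⟩ := hs
  have key : ∀ p : ℝ[X], Integrable (fun x => p.eval x) μ ∧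
      rieszFunctional s p = ∫ x, p.eval x ∂μ := by
    intro p
    induction p using Polynomial.induction_on' with
    | add p q hp hq =>
      simp only [eval_add]
      exact ⟨hp.1.add hq.1, by rw [map_add, hp.2, hq.2, integral_add hp.1 hq.1]⟩
    | monomial n a =>
      simp only [eval_monomial]
      exact ⟨(hμ n).const_mul a, by
        rw [rieszFunctional_monomial, integral_const_mul, hs, mul_comm]⟩
  intro q
  rw [(key _).2]
  refine integral_nonneg fun x => ?_
  simp only [eval_mul]
  exact mul_self_nonneg _

lemma threePointMoments_mem_momentSequences (u : ℝ) {a b c : ℝ} (ha : 0 ≤ a) (hb : 0 ≤ b)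
    (hc : 0 ≤ c) :
    (fun k : ℕ => a * (-1) ^ k + b * u ^ k + c) ∈ momentSequences {-1, u, 1} := by
  have hint : ∀ (t r : ℝ) (k : ℕ),
      Integrable (fun x : ℝ => x ^ k) (ENNReal.ofReal t • Measure.dirac r) := fun t r k =>
    (integrable_dirac (by simp)).smul_measure ENNReal.ofReal_ne_top
  refine ⟨ENNReal.ofReal a • Measure.dirac (-1) + ENNReal.ofReal b • Measure.dirac u +
    ENNReal.ofReal c • Measure.dirac 1, fun k => ((hint _ _ k).add_measure (hint _ _ k)).add_measure
      (hint _ _ k), by simp, fun k => ?_⟩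
  rw [integral_add_measure ((hint _ _ k).add_measure (hint _ _ k)) (hint _ _ k),
    integral_add_measure (hint _ _ k) (hint _ _ k)]
  simp [integral_smul_measure, ENNReal.toReal_ofReal, ha, hb, hc]

lemma eRank_hankelMatrix_threePointMoments_le (u a b c : ℝ) :
    (hankelMatrix fun k : ℕ => a * (-1) ^ k + b * u ^ k + c).eRank ≤ 3 := by
  classical
  set S : Finset (ℕ → ℝ) := {fun i => (-1) ^ i, fun i => u ^ i, fun _ => 1} with hS
  have hspan : Submodule.span ℝ (range (hankelMatrix fun k : ℕ =>
      a * (-1) ^ k + b * u ^ k + c).col) ≤ Submodule.span ℝ (S : Set (ℕ → ℝ)) := by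
    rw [Submodule.span_le]
    rintro _ ⟨j, rfl⟩
    have e : (hankelMatrix fun k : ℕ => a * (-1) ^ k + b * u ^ k + c).col j =
        (a * (-1) ^ j) • (fun i : ℕ => (-1 : ℝ) ^ i) + (b * u ^ j) • (fun i : ℕ => u ^ i) +
          c • (fun _ : ℕ => (1 : ℝ)) := by
      funext i
      simp only [hankelMatrix, Matrix.col_apply, Matrix.of_apply, Pi.add_apply, Pi.smul_apply,
        smul_eq_mul, pow_add]
      ring
    rw [e]
    refine add_mem (add_mem ?_ ?_) ?_ <;>
      exact Submodule.smul_mem _ _ (Submodule.subset_span (by simp [hS]))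
  have h1 : (hankelMatrix fun k : ℕ => a * (-1) ^ k + b * u ^ k + c).cRank ≤ (3 : ℕ) :=
    (Submodule.rank_mono hspan).trans ((rank_span_finset_le S).trans
      (by exact_mod_cast Finset.card_le_three))
  exact (OrderHomClass.mono Cardinal.toENat h1).trans_eq (map_natCast _ 3)

end Hankel

/-! ### The main theorem. -/

theorem theorem4p1 (F : ℝ → ℝ) :
    List.TFAE
      [ ∀ s ∈ ⋃ u ∈ Set.Ioo (0 : ℝ) 1, momentSequences {-1, u, 1},
          (fun k => F (s k)) ∈ momentSequences Set.univ,
        ∀ s ∈ momentSequences (Set.Icc (-1) 1),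
          (fun k => F (s k)) ∈ momentSequences Set.univ,
        IsRestrictionOfAbsMonotonicEntire F ] ∧
    ((∀ s : ℕ → ℝ, (hankelMatrix s).PosSemidef → (hankelMatrix s).eRank ≤ 3 →
        ((hankelMatrix s).map F).PosSemidef) →
      IsRestrictionOfAbsMonotonicEntire F ∧
        ∀ (n : ℕ) (A : Matrix (Fin n) (Fin n) ℝ), A.PosSemidef → (A.map F).PosSemidef) := by
  refine ⟨?_, fun h => ?_⟩
  · tfae_have 1 → 3 := by
      intro h
      refine PreservesThreePointMoments.hasNonnegPowerSeries
        (fun u hu a b c ha hb hc => ?_) |>.isRestrictionOfAbsMonotonicEntire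
      exact isPosSemidefSeq_of_mem_momentSequences (h _ (Set.mem_biUnion hu
        (threePointMoments_mem_momentSequences u ha hb hc)))
    tfae_have 3 → 2 := fun h s hs => h.hasNonnegPowerSeries.comp_mem_momentSequences hs
    tfae_have 2 → 1 := by
      intro h s hs
      obtain ⟨u, hu, hs⟩ := Set.mem_iUnion₂.1 hs
      refine h s (momentSequences_mono ?_ hs)
      rintro x (rfl | rfl | rfl)
      · norm_num
      · exact ⟨by linarith [hu.1], hu.2.le⟩
      · norm_num
    tfae_finish
  · have hF : HasNonnegPowerSeries F := by
      refine PreservesThreePointMoments.hasNonnegPowerSeries fun u hu a b c ha hb hc => ?_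
      have h1 := isPosSemidefSeq_of_mem_momentSequences
        (threePointMoments_mem_momentSequences u ha hb hc)
      exact posSemidef_hankelMatrix_iff.1 (h _ (posSemidef_hankelMatrix_iff.2 h1)
        (eRank_hankelMatrix_threePointMoments_le u a b c))
    exact ⟨hF.isRestrictionOfAbsMonotonicEntire, fun n A hA => hF.posSemidef_map hA⟩
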